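/- Let $X$ be a real Banach lattice. Write $X^{\sim}$ for its order dual (the order bounded linear functionals on $X$, i.e. those bounded on every order interval, ordered by $f\le g$ iff $f(x)\le g(x)$ for all $x\ge 0$), $X^{\sim\sim}=(X^{\sim})^{\sim}$, and $\hat x\in X^{\sim\sim}$, $\hat x(f)=f(x)$, for $x\in X$. A net $(x_\alpha)$ in $X$ *order converges* to $x$ if there is a net $v_\gamma\downarrow 0$ in $X$ such that for every $\gamma$ one has $|x_\alpha-x|\le v_\gamma$ for all sufficiently large $\alpha$; it is *uo-null* if $|x_\alpha|\wedge u$ order converges to $0$ for every $u\in X_+$. A subset $A\subseteq X$ is *$b$-bounded* if $\{\hat x: x\in A\}$ is order bounded in $X^{\sim\sim}$; a sequence is $b$-bounded if its set of terms is. Let $X^{\sim}_{bbuo}$ be the set of all $y\in X^{\sim}$ such that $y(x_\alpha)\to 0$ for every uo-null net $(x_\alpha)$ in $X$ that has a $b$-bounded tail $\{x_\alpha:\alpha\ge\alpha_0\}$. **Theorem 3.3.** Let $y$ be an order continuous linear functional on $X$, i.e. $y(x_\alpha)\to 0$ for every net $(x_\alpha)$ in $X$ that order converges to $0$. Then the following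 conditions are equivalent: 1. $y\in X^{\sim}_{bbuo}$; 2. $y(x_n)\to 0$ for every $b$-bounded uo-null sequence $(x_n)$ in $X$; 3. $y(x_n)\to 0$ for every $b$-bounded disjoint sequence $(x_n)$ in $X$ (disjoint: $|x_m|\wedge|x_n|=0$ for $m\ne n$). -/

import Mathlib

open Filter Topology Set

section OrderedSpace

variable {E : Type*} [AddCommMonoid E] [Module ℝ E] [Preorder E]

/-- A linear functional is order bounded if it is bounded on every order interval. -/
def IsOrderBoundedFunctional (f : E →ₗ[ℝ] ℝ) : Prop :=
  ∀ a b : E, ∃ M : ℝ, ∀ x ∈ Set.Icc a b, |f x| ≤ M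

variable (E) in
/-- The order dual `E^~`: the space of all order bounded linear functionals on `E`. -/
def orderBoundedDual : Submodule ℝ (E →ₗ[ℝ] ℝ) where
  carrier := {f | IsOrderBoundedFunctional f}
  add_mem' := by
    intro f g hf hg a b
    obtain ⟨M, hM⟩ := hf a b
    obtain ⟨N, hN⟩ := hg a b
    exact ⟨M + N, fun x hx => (abs_add_le _ _).trans (add_le_add (hM x hx) (hN x hx))⟩
  zero_mem' := fun _ _ => ⟨0, fun x _ => by simp⟩
  smul_mem' := by
    intro c f hf a b
    obtain ⟨M, hM⟩ := hf a b
    refine ⟨|c| * M, fun x hx => ?_⟩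
    simpa [abs_mul] using mul_le_mul_of_nonneg_left (hM x hx) (abs_nonneg c)

/-- The usual order of the order dual: `f ≤ g` iff `f x ≤ g x` for all `x ≥ 0`. (Over a vector
lattice it is a lattice order; only the order relation itself is used below.) -/
instance orderBoundedDual.instPreorder : Preorder (orderBoundedDual E) where
  le f g := ∀ x : E, 0 ≤ x → (f : E →ₗ[ℝ] ℝ) x ≤ (g : E →ₗ[ℝ] ℝ) x
  le_refl _ _ _ := le_rfl
  le_trans _ _ _ h₁ h₂ x hx := (h₁ x hx).trans (h₂ x hx)

end OrderedSpace

section VectorLattice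

variable {X : Type*} [AddCommGroup X] [Lattice X] [IsOrderedAddMonoid X] [Module ℝ X]

theorem isOrderBoundedFunctional_apply (x : X) :
    IsOrderBoundedFunctional
      ((LinearMap.applyₗ x).comp (orderBoundedDual X).subtype : orderBoundedDual X →ₗ[ℝ] ℝ) := by
  intro a b
  refine ⟨max |a.1 x⁺| |b.1 x⁺| + max |a.1 x⁻| |b.1 x⁻|, fun f hf => ?_⟩
  have key : ∀ z : X, 0 ≤ z → |f.1 z| ≤ max |a.1 z| |b.1 z| := fun z hz =>
    abs_le_max_abs_abs (hf.1 z hz) (hf.2 z hz)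
  have hx : f.1 x = f.1 x⁺ - f.1 x⁻ := by rw [← map_sub, posPart_sub_negPart]
  change |f.1 x| ≤ _
  rw [hx]
  exact (abs_sub _ _).trans
    (add_le_add (key _ (posPart_nonneg x)) (key _ (negPart_nonneg x)))

variable (X) in
/-- The canonical map `x ↦ x̂`, `x̂ (y) = y x`, of `X` into its second order dual `X^~~`. -/
def evalBidual : X →ₗ[ℝ] orderBoundedDual (orderBoundedDual X) where
  toFun x := ⟨(LinearMap.applyₗ x).comp (orderBoundedDual X).subtype,
    isOrderBoundedFunctional_apply x⟩
  map_add' x₁ x₂ := by ext y; simp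
  map_smul' c x := by ext y; simp

/-- `A ⊆ X` is `b`-order bounded: its image in the second order dual is order bounded. -/
def IsBOrderBounded (A : Set X) : Prop :=
  BddBelow (evalBidual X '' A) ∧ BddAbove (evalBidual X '' A)

/-- Order convergence of a net `x` to `l`: there is a net decreasing to `0` (here given by its set
of values: a nonempty downward directed set `D` with infimum `0`) each member of which eventually
dominates `|x i - l|`. -/
def OrderConverges {ι : Type*} [Preorder ι] (x : ι → X) (l : X) : Prop :=
  ∃ D : Set X, D.Nonempty ∧ DirectedOn (· ≥ ·) D ∧ IsGLB D 0 ∧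
    ∀ d ∈ D, ∃ i₀ : ι, ∀ i, i₀ ≤ i → |x i - l| ≤ d

/-- Unbounded order convergence: `|x i - l| ⊓ u` order converges to `0` for every `u ≥ 0`. -/
def UOConverges {ι : Type*} [Preorder ι] (x : ι → X) (l : X) : Prop :=
  ∀ u : X, 0 ≤ u → OrderConverges (fun i => |x i - l| ⊓ u) 0

/-- `bbuo`-convergence: unbounded order convergence of a net that is eventually order bounded in
the second order dual. -/
def BBUOConverges {ι : Type*} [Preorder ι] (x : ι → X) (l : X) : Prop :=
  UOConverges x l ∧ ∃ i₀ : ι, IsBOrderBounded (x '' Set.Ici i₀)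

end VectorLattice

section Functionals

universe u

variable {X : Type u} [AddCommGroup X] [Lattice X] [Module ℝ X]

/-- An order continuous functional: it maps every net that order converges to `0` to a net of
reals converging to `0`. Index sets in the universe of `X` suffice, since all that matters about
a net is the filter on `X` generated by its tails. -/
def IsOrderContinuousFunctional (y : X →ₗ[ℝ] ℝ) : Prop :=
  ∀ (ι : Type u) [Preorder ι] [IsDirectedOrder ι] [Nonempty ι] (x : ι → X),
    OrderConverges x 0 → Tendsto (fun i => y (x i)) atTop (𝓝 0)

variable (X) in
/-- The `bbuo`-dual: the order bounded functionals that map every `bbuo`-null net to a net of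
reals converging to `0`. -/
def bbuoDual [IsOrderedAddMonoid X] : Set (X →ₗ[ℝ] ℝ) :=
  {y | y ∈ orderBoundedDual X ∧
    ∀ (ι : Type u) [Preorder ι] [IsDirectedOrder ι] [Nonempty ι] (x : ι → X),
      BBUOConverges x 0 → Tendsto (fun i => y (x i)) atTop (𝓝 0)}

end Functionals

/-! The implication from nets to sequences is a specialisation, and disjoint sequences are uo-null
(`uoConverges_of_disjoint`), so the weight lies in returning from disjoint sequences to arbitrary
nets.

Let S be the solid hull of a b-bounded tail. S is again b-bounded (`IsBOrderBounded.solidHull`) and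
therefore norm bounded, by uniform boundedness (`IsBOrderBounded.exists_norm_le`). A gliding hump
argument (`exists_forall_abs_apply_posPart_sub_le`) then gives, for each ε > 0, some u ≥ 0 with
|y((z - u)⁺)| ≤ ε for all positive z in S: otherwise a disjoint sequence could be built in S along
which y does not tend to 0. Write z = (z - u)⁺ + z ⊓ u for z the positive and negative parts of the
terms of the net. The first summands contribute at most ε each. The truncations z ⊓ u order converge
to 0, and y is order continuous.

Solidity of b-boundedness needs positive parts in the second order dual. They come from the
Riesz–Kantorovich formula, proved for any ordered space with a generating cone and Riesz
decomposition so that it applies both to X and to its order dual. -/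

/-! ### Riesz–Kantorovich theory of the order dual. -/

section OrderDual

variable {E : Type*} [AddCommGroup E] [Preorder E] [IsOrderedAddMonoid E] [Module ℝ E]

/-- A positively homogeneous additive function on a generating cone extends linearly. -/
theorem exists_linearMap_eq_on_nonneg
    (hgen : ∀ x : E, ∃ p q : E, 0 ≤ p ∧ 0 ≤ q ∧ x = p - q) [PosSMulMono ℝ E] (φ : E → ℝ)
    (hadd : ∀ p q, 0 ≤ p → 0 ≤ q → φ (p + q) = φ p + φ q)
    (hsmul : ∀ c : ℝ, 0 < c → ∀ p, 0 ≤ p → φ (c • p) ≤ c * φ p) :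
    ∃ f : E →ₗ[ℝ] ℝ, ∀ p, 0 ≤ p → f p = φ p := by
  have h0 : φ 0 = 0 := by simpa using hadd 0 0 le_rfl le_rfl
  have hs : ∀ c : ℝ, 0 ≤ c → ∀ p, 0 ≤ p → φ (c • p) = c * φ p := by
    intro c hc p hp
    rcases hc.eq_or_lt with rfl | hc
    · simp [h0]
    · refine le_antisymm (hsmul c hc p hp) ?_
      -- The reverse inequality is the hypothesis for c⁻¹ at the point c • p.
      have := hsmul c⁻¹ (inv_pos.2 hc) (c • p) (smul_nonneg hc.le hp)
      rw [inv_smul_smul₀ hc.ne'] at this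
      calc c * φ p ≤ c * (c⁻¹ * φ (c • p)) := by gcongr
        _ = φ (c • p) := by field_simp
  choose P Q hP hQ hPQ using hgen
  -- The value does not depend on the chosen decomposition; linearity follows by picking convenient
  -- ones.
  have key : ∀ x p q, 0 ≤ p → 0 ≤ q → x = p - q → φ (P x) - φ (Q x) = φ p - φ q := by
    intro x p q hp hq hx
    have h1 : P x + q = p + Q x := by
      have h2 := (hPQ x).symm.trans hx
      rw [sub_eq_sub_iff_add_eq_add] at h2
      exact h2
    have h3 := hadd _ _ (hP x) hq
    have h4 := hadd _ _ hp (hQ x)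
    rw [h1] at h3
    linarith
  refine ⟨{ toFun := fun x => φ (P x) - φ (Q x), map_add' := ?_, map_smul' := ?_ }, ?_⟩
  · intro a b
    rw [key (a + b) (P a + P b) (Q a + Q b) (add_nonneg (hP a) (hP b))
      (add_nonneg (hQ a) (hQ b)) (by
        conv_lhs => rw [hPQ a, hPQ b]
        abel), hadd _ _ (hP a) (hP b), hadd _ _ (hQ a) (hQ b)]
    ring
  · intro c a
    rcases le_total 0 c with hc | hc
    · rw [key (c • a) (c • P a) (c • Q a) (smul_nonneg hc (hP a)) (smul_nonneg hc (hQ a)) (by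
        conv_lhs => rw [hPQ a]
        rw [smul_sub]), hs c hc _ (hP a), hs c hc _ (hQ a)]
      simp only [RingHom.id_apply, smul_eq_mul]
      ring
    · have hc' : 0 ≤ -c := neg_nonneg.2 hc
      rw [key (c • a) ((-c) • Q a) ((-c) • P a) (smul_nonneg hc' (hQ a))
        (smul_nonneg hc' (hP a)) (by
        conv_lhs => rw [hPQ a]
        module), hs _ hc' _ (hP a), hs _ hc' _ (hQ a)]
      simp only [RingHom.id_apply, smul_eq_mul]
      ring
  · intro p hp
    change φ (P p) - φ (Q p) = φ p
    rw [key p p 0 hp le_rfl (by simp), h0, sub_zero]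

/-- The Riesz decomposition property. -/
def RieszDecomposition (E : Type*) [AddCommGroup E] [Preorder E] : Prop :=
  ∀ w a b : E, 0 ≤ w → 0 ≤ a → 0 ≤ b → w ≤ a + b →
    ∃ w₁ w₂ : E, 0 ≤ w₁ ∧ w₁ ≤ a ∧ 0 ≤ w₂ ∧ w₂ ≤ b ∧ w = w₁ + w₂

/-- Every element is a difference of nonnegative ones. -/
def GeneratingCone (E : Type*) [AddCommGroup E] [Preorder E] : Prop :=
  ∀ x : E, ∃ p q : E, 0 ≤ p ∧ 0 ≤ q ∧ x = p - q

theorem isOrderBoundedFunctional_of_nonneg {g : E →ₗ[ℝ] ℝ} (hg : ∀ p, 0 ≤ p → 0 ≤ g p) :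
    IsOrderBoundedFunctional g := by
  have hmono : ∀ a b, a ≤ b → g a ≤ g b := fun a b hab => by
    have := hg (b - a) (sub_nonneg.2 hab)
    rw [map_sub] at this
    linarith
  exact fun a b => ⟨max |g a| |g b|, fun x hx =>
    abs_le_max_abs_abs (hmono _ _ hx.1) (hmono _ _ hx.2)⟩

theorem orderBoundedDual.apply_mono {f : orderBoundedDual E} (hf : 0 ≤ f) {a b : E} (h : a ≤ b) :
    f.1 a ≤ f.1 b := by
  have h1 : 0 ≤ f.1 (b - a) := hf (b - a) (sub_nonneg.2 h)
  rw [map_sub] at h1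
  exact sub_nonneg.1 h1

/-- The Riesz–Kantorovich formula, with the supremum restricted to an ideal `I`. -/
theorem exists_isLUB_functional [PosSMulMono ℝ E] (hR : RieszDecomposition E)
    (hgen : GeneratingCone E) (f : orderBoundedDual E) (I : Set E) (I0 : (0 : E) ∈ I)
    (Iadd : ∀ a ∈ I, ∀ b ∈ I, a + b ∈ I) (Ismul : ∀ c : ℝ, 0 < c → ∀ a ∈ I, c • a ∈ I)
    (Ile : ∀ a b, 0 ≤ a → a ≤ b → b ∈ I → a ∈ I) :
    ∃ g : orderBoundedDual E, 0 ≤ g ∧ ∀ p, 0 ≤ p →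
      IsLUB (f.1 '' {w | 0 ≤ w ∧ w ≤ p ∧ w ∈ I}) (g.1 p) := by
  set φ : E → ℝ := fun p => sSup (f.1 '' {w | 0 ≤ w ∧ w ≤ p ∧ w ∈ I}) with hφ
  have hlub : ∀ p, 0 ≤ p → IsLUB (f.1 '' {w | 0 ≤ w ∧ w ≤ p ∧ w ∈ I}) (φ p) := by
    intro p hp
    obtain ⟨M, hM⟩ := f.2 0 p
    refine isLUB_csSup ⟨_, 0, ⟨le_rfl, hp, I0⟩, rfl⟩ ⟨M, ?_⟩
    rintro _ ⟨w, hw, rfl⟩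
    exact (le_abs_self _).trans (hM w ⟨hw.1, hw.2.1⟩)
  have hle : ∀ p, 0 ≤ p → ∀ w, 0 ≤ w → w ≤ p → w ∈ I → f.1 w ≤ φ p := fun p hp w h1 h2 h3 =>
    (hlub p hp).1 ⟨w, ⟨h1, h2, h3⟩, rfl⟩
  have hub : ∀ p, 0 ≤ p → ∀ M, (∀ w, 0 ≤ w → w ≤ p → w ∈ I → f.1 w ≤ M) → φ p ≤ M := by
    intro p hp M h
    refine (hlub p hp).2 ?_
    rintro _ ⟨w, hw, rfl⟩
    exact h w hw.1 hw.2.1 hw.2.2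
  obtain ⟨g, hg⟩ := exists_linearMap_eq_on_nonneg hgen φ (by
    intro p q hp hq
    refine le_antisymm (hub _ (add_nonneg hp hq) _ ?_) ?_
    · intro w hw hwpq hwI
      obtain ⟨w₁, w₂, h1, h2, h3, h4, rfl⟩ := hR w p q hw hp hq hwpq
      rw [map_add]
      exact add_le_add
        (hle p hp w₁ h1 h2 (Ile _ _ h1 (le_add_of_nonneg_right h3) hwI))
        (hle q hq w₂ h3 h4 (Ile _ _ h3 (le_add_of_nonneg_left h1) hwI))
    · rw [← le_sub_iff_add_le]
      refine hub p hp _ fun a h1 h2 h3 => ?_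
      rw [le_sub_comm]
      refine hub q hq _ fun b h4 h5 h6 => ?_
      rw [le_sub_iff_add_le, ← map_add, add_comm]
      exact hle _ (add_nonneg hp hq) _ (add_nonneg h1 h4) (add_le_add h2 h5)
        (Iadd a h3 b h6)) (by
    intro c hc p hp
    refine hub _ (smul_nonneg hc.le hp) _ fun w h1 h2 h3 => ?_
    have := hle p hp (c⁻¹ • w) (smul_nonneg (inv_nonneg.2 hc.le) h1) (by
      have := smul_le_smul_of_nonneg_left h2 (inv_nonneg.2 hc.le)
      rwa [inv_smul_smul₀ hc.ne'] at this) (Ismul _ (inv_pos.2 hc) _ h3)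
    rw [map_smul, smul_eq_mul] at this
    calc f.1 w = c * (c⁻¹ * f.1 w) := by field_simp
      _ ≤ c * φ p := by gcongr)
  have hpos : ∀ p, 0 ≤ p → 0 ≤ g p := fun p hp => by
    rw [hg p hp]
    simpa using hle p hp 0 le_rfl hp I0
  exact ⟨⟨g, isOrderBoundedFunctional_of_nonneg hpos⟩, hpos, fun p hp => by
    simpa only [hg p hp] using hlub p hp⟩

/-- Positive parts exist in the order dual. -/
theorem orderBoundedDual.exists_posPart [PosSMulMono ℝ E] (hR : RieszDecomposition E)
    (hgen : GeneratingCone E) (f : orderBoundedDual E) :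
    ∃ g : orderBoundedDual E, 0 ≤ g ∧ f ≤ g ∧ ∀ h, 0 ≤ h → f ≤ h → g ≤ h := by
  obtain ⟨g, hg0, hg⟩ := exists_isLUB_functional hR hgen f Set.univ trivial
    (fun _ _ _ _ => trivial) (fun _ _ _ _ => trivial) (fun _ _ _ _ _ => trivial)
  refine ⟨g, hg0, fun p hp => (hg p hp).1 ⟨p, ⟨hp, le_rfl, trivial⟩, rfl⟩, fun h h0 hfh p hp => ?_⟩
  refine (hg p hp).2 ?_
  rintro _ ⟨w, ⟨hw, hwp, -⟩, rfl⟩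
  exact (hfh w hw).trans (apply_mono h0 hwp)

instance orderBoundedDual.instIsOrderedAddMonoid : IsOrderedAddMonoid (orderBoundedDual E) where
  add_le_add_left _ _ h _ x hx := add_le_add_left (h x hx) _

instance orderBoundedDual.instPosSMulMono : PosSMulMono ℝ (orderBoundedDual E) where
  smul_le_smul_of_nonneg_left _ hc _ _ h x hx := mul_le_mul_of_nonneg_left (h x hx) hc

theorem orderBoundedDual.generatingCone [PosSMulMono ℝ E] (hR : RieszDecomposition E)
    (hgen : GeneratingCone E) : GeneratingCone (orderBoundedDual E) := by
  intro f
  obtain ⟨g, h0, hfg, -⟩ := orderBoundedDual.exists_posPart hR hgen f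
  exact ⟨g, g - f, h0, sub_nonneg.2 hfg, (sub_sub_cancel g f).symm⟩

/-- With g = (w - a)⁺, the piece w - g plays the role of w ⊓ a. Minimality of g gives both g ≤ w and
g ≤ b. -/
theorem orderBoundedDual.rieszDecomposition [PosSMulMono ℝ E] (hR : RieszDecomposition E)
    (hgen : GeneratingCone E) : RieszDecomposition (orderBoundedDual E) := by
  intro w a b hw ha hb hwab
  obtain ⟨g, h0, hg, hmin⟩ := orderBoundedDual.exists_posPart hR hgen (w - a)
  refine ⟨w - g, g, sub_nonneg.2 (hmin w hw (sub_le_self _ ha)), ?_, h0,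
    hmin b hb (sub_le_iff_le_add'.2 hwab), (sub_add_cancel w g).symm⟩
  exact sub_le_comm (a := w).1 hg

end OrderDual

/-! ### Stability of order convergence. -/

section OrderConvergence

universe u

variable {X : Type u} [AddCommGroup X] [Lattice X]

theorem OrderConverges.of_abs_le {ι : Type*} [Preorder ι] {x z : ι → X}
    (hx : OrderConverges x 0) (h : ∀ i, |z i| ≤ |x i|) : OrderConverges z 0 := by
  obtain ⟨D, h1, h2, h3, h4⟩ := hx
  refine ⟨D, h1, h2, h3, fun d hd => ?_⟩
  obtain ⟨i₀, hi₀⟩ := h4 d hd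
  refine ⟨i₀, fun i hi => ?_⟩
  have := hi₀ i hi
  rw [sub_zero] at this ⊢
  exact (h i).trans this

/-- Lets a sequence serve as a net whose index set lies in the universe of X, as `bbuoDual` demands.
-/
theorem OrderConverges.comp_uliftDown {x : ℕ → X} {l : X} (hx : OrderConverges x l) :
    OrderConverges (fun i : ULift.{u} ℕ => x i.down) l := by
  obtain ⟨D, h1, h2, h3, h4⟩ := hx
  refine ⟨D, h1, h2, h3, fun d hd => ?_⟩
  obtain ⟨i₀, hi₀⟩ := h4 d hd
  exact ⟨⟨i₀⟩, fun i hi => hi₀ i.down hi⟩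

end OrderConvergence

/-! ### Disjoint sums, and solidity of b-boundedness. -/

section VectorLatticeDual

variable {X : Type*} [AddCommGroup X] [Lattice X] [IsOrderedAddMonoid X]

theorem rieszDecomposition_of_lattice : RieszDecomposition X := by
  intro w a b hw ha hb hwab
  refine ⟨w ⊓ a, w - w ⊓ a, le_inf hw ha, inf_le_right, sub_nonneg.2 inf_le_left, ?_, by abel⟩
  rw [sub_le_comm]
  exact le_inf (sub_le_self _ hb) (sub_le_iff_le_add.2 hwab)

theorem generatingCone_of_lattice : GeneratingCone X := fun x =>
  ⟨x⁺, x⁻, posPart_nonneg x, negPart_nonneg x, (posPart_sub_negPart x).symm⟩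

/-- The sum of disjoint positive elements is their supremum, since a + b = a ⊓ b + a ⊔ b. The second
conjunct keeps the next term disjoint from the partial sum. -/
theorem sum_le_of_disjoint {z : ℕ → X} (hz : ∀ n, 0 ≤ z n)
    (hd : ∀ m n, m ≠ n → z m ⊓ z n = 0) {v : X} (hv : ∀ n, z n ≤ v) (n : ℕ) :
    ∑ i ∈ Finset.range n, z i ≤ v ∧ ∀ k, n ≤ k → z k ⊓ ∑ i ∈ Finset.range n, z i = 0 := by
  have hdis : ∀ n k, n ≤ k → z k ⊓ ∑ i ∈ Finset.range n, z i = 0 := by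
    intro n
    induction n with
    | zero => intro k _; simpa using hz k
    | succ n ih =>
      intro k hk
      refine le_antisymm ?_ (le_inf (hz k) (Finset.sum_nonneg fun i _ => hz i))
      rw [Finset.sum_range_succ]
      set s := ∑ i ∈ Finset.range n, z i
      set t := z k ⊓ (s + z n)
      have hs : 0 ≤ s := Finset.sum_nonneg fun i _ => hz i
      have h1 : t - z n ≤ 0 := by
        rw [← ih k (by omega)]
        exact le_inf ((sub_le_self _ (hz n)).trans inf_le_left)
          (sub_le_iff_le_add.2 inf_le_right)
      rw [← hd k n (by omega)]
      exact le_inf inf_le_left (sub_nonpos.1 h1)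
  refine ⟨?_, hdis n⟩
  induction n with
  | zero => exact (hz 0).trans (hv 0)
  | succ n ih =>
    rw [Finset.sum_range_succ, add_comm, ← inf_add_sup, hdis n n le_rfl, zero_add]
    exact sup_le (hv n) ih

theorem sub_sum_ge_of_disjoint {z : ℕ → X} (hz : ∀ n, 0 ≤ z n)
    (hd : ∀ m n, m ≠ n → z m ⊓ z n = 0) {v : X} (hv : ∀ n, z n ≤ v) {n k : ℕ} (hk : n ≤ k) :
    z k ≤ v - ∑ i ∈ Finset.range n, z i := by
  obtain ⟨h1, h2⟩ := sum_le_of_disjoint hz hd hv n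
  rw [le_sub_iff_add_le, ← inf_add_sup, h2 k hk, zero_add]
  exact sup_le (hv k) h1

/-- The solid hull of a set. -/
def solidHull (A : Set X) : Set X := {z | ∃ x ∈ A, |z| ≤ |x|}

variable [Module ℝ X]

theorem IsBOrderBounded.mono {A B : Set X} (hB : IsBOrderBounded B) (h : A ⊆ B) :
    IsBOrderBounded A :=
  ⟨hB.1.mono (Set.image_mono h), hB.2.mono (Set.image_mono h)⟩

theorem evalBidual_mono {x z : X} (h : x ≤ z) : evalBidual X x ≤ evalBidual X z := by
  exact fun f hf => orderBoundedDual.apply_mono hf h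

variable [PosSMulMono ℝ X]

/-- The functional g is f cut down to the ideal generated by x⁺: it agrees with f at x⁺ and vanishes
at x⁻, because x⁺ ⊓ x⁻ = 0. It turns a bound on x̂ into a bound on the image of x⁺. -/
theorem exists_le_apply_eq_posPart (f : orderBoundedDual X) (hf : 0 ≤ f) (x : X) :
    ∃ g : orderBoundedDual X, 0 ≤ g ∧ g ≤ f ∧ g.1 x = f.1 x⁺ := by
  have hmono : ∀ a b, a ≤ b → f.1 a ≤ f.1 b := fun _ _ hab =>
    orderBoundedDual.apply_mono hf hab
  have hx := posPart_nonneg x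
  obtain ⟨g, hg0, hg⟩ := exists_isLUB_functional rieszDecomposition_of_lattice
    generatingCone_of_lattice f {w | ∃ r : ℝ, 1 ≤ r ∧ w ≤ r • x⁺} ⟨1, le_rfl, by simp⟩
    (by
      rintro a ⟨r, hr, har⟩ b ⟨s, hs, hbs⟩
      exact ⟨r + s, by linarith, by rw [add_smul]; exact add_le_add har hbs⟩)
    (by
      rintro c hc a ⟨r, hr, har⟩
      refine ⟨c * r + 1, by nlinarith, ?_⟩
      rw [add_smul, mul_smul, one_smul]
      exact le_add_of_le_of_nonneg (smul_le_smul_of_nonneg_left har hc.le) hx)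
    (by
      rintro a b - hab ⟨r, hr, hbr⟩
      exact ⟨r, hr, hab.trans hbr⟩)
  refine ⟨g, hg0, fun p hp => (hg p hp).2 ?_, ?_⟩
  · rintro _ ⟨w, ⟨-, hw, -⟩, rfl⟩
    exact hmono _ _ hw
  · have h1 : g.1 x⁺ = f.1 x⁺ := by
      refine (hg _ hx).unique ⟨?_, fun b hb => hb ⟨x⁺, ⟨hx, le_rfl, 1, le_rfl, by simp⟩, rfl⟩⟩
      rintro _ ⟨w, ⟨-, hw, -⟩, rfl⟩
      exact hmono _ _ hw
    have h2 : g.1 x⁻ ≤ 0 := by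
      refine (hg _ (negPart_nonneg x)).2 ?_
      rintro _ ⟨w, ⟨hw0, hw, r, hr, hwr⟩, rfl⟩
      have hr0 : 0 < r := by linarith
      -- Requiring r ≥ 1 in the ideal makes r⁻¹ • w ≤ w ≤ x⁻.
      have hle : r⁻¹ • w ≤ x⁺ ⊓ x⁻ := by
        refine le_inf ?_ ?_
        · have := smul_le_smul_of_nonneg_left hwr (inv_nonneg.2 hr0.le)
          rwa [inv_smul_smul₀ hr0.ne'] at this
        · have h3 : r⁻¹ • w ≤ (1 : ℝ) • w := by
            rw [← sub_nonneg, ← sub_smul]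
            exact smul_nonneg (sub_nonneg.2 (inv_le_one_of_one_le₀ hr)) hw0
          rw [one_smul] at h3
          exact h3.trans hw
      rw [posPart_inf_negPart_eq_zero] at hle
      have := hmono _ _ hle
      rw [map_smul, map_zero, smul_eq_mul] at this
      exact nonpos_of_mul_nonpos_right this (inv_pos.2 hr0)
    have h3 : 0 ≤ g.1 x⁻ := hg0 _ (negPart_nonneg x)
    calc g.1 x = g.1 x⁺ - g.1 x⁻ := by rw [← map_sub, posPart_sub_negPart]
      _ = f.1 x⁺ := by rw [h1, le_antisymm h2 h3, sub_zero]

/-- A positive majorant H of x̂ also dominates the image of x⁺, since f(x⁺) = g(x) ≤ H(g) ≤ H(f) for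
a suitable 0 ≤ g ≤ f. Apply this to x and -x and add. -/
theorem exists_bidual_bound {A : Set X} (hA : IsBOrderBounded A) :
    ∃ G : orderBoundedDual (orderBoundedDual X), ∀ x ∈ A, evalBidual X |x| ≤ G := by
  obtain ⟨⟨L, hL⟩, ⟨F, hF⟩⟩ := hA
  have hR : RieszDecomposition (orderBoundedDual X) :=
    orderBoundedDual.rieszDecomposition rieszDecomposition_of_lattice generatingCone_of_lattice
  have hG : GeneratingCone (orderBoundedDual X) :=
    orderBoundedDual.generatingCone rieszDecomposition_of_lattice generatingCone_of_lattice
  have key : ∀ H : orderBoundedDual (orderBoundedDual X), 0 ≤ H → ∀ x : X,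
      evalBidual X x ≤ H → ∀ f : orderBoundedDual X, 0 ≤ f → f.1 x⁺ ≤ H.1 f := by
    intro H hH x hx f hf
    obtain ⟨g, hg0, hgf, hgx⟩ := exists_le_apply_eq_posPart f hf x
    have h1 : g.1 x ≤ H.1 g := hx g hg0
    exact hgx ▸ h1.trans (orderBoundedDual.apply_mono hH hgf)
  obtain ⟨F', hF0, hFF, -⟩ := orderBoundedDual.exists_posPart hR hG F
  obtain ⟨L', hL0, hLL, -⟩ := orderBoundedDual.exists_posPart hR hG (-L)
  refine ⟨F' + L', fun x hx f hf => ?_⟩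
  have h1 := key F' hF0 x ((hF ⟨x, hx, rfl⟩).trans hFF) f hf
  have h2 := key L' hL0 (-x) (fun g hg => by
    have h3 : L.1 g ≤ g.1 x := hL ⟨x, hx, rfl⟩ g hg
    have h4 : -L.1 g ≤ L'.1 g := hLL g hg
    change g.1 (-x) ≤ L'.1 g
    rw [map_neg]
    linarith) f hf
  rw [posPart_neg] at h2
  change f.1 |x| ≤ F'.1 f + L'.1 f
  rw [← posPart_add_negPart, map_add]
  exact add_le_add h1 h2

theorem IsBOrderBounded.solidHull {A : Set X} (hA : IsBOrderBounded A) :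
    IsBOrderBounded (solidHull A) := by
  obtain ⟨G, hG⟩ := exists_bidual_bound hA
  refine ⟨⟨-G, ?_⟩, ⟨G, ?_⟩⟩
  · rintro _ ⟨z, ⟨x, hx, hzx⟩, rfl⟩
    intro f hf
    have h1 : f.1 (-z) ≤ G.1 f :=
      (evalBidual_mono ((neg_le_abs z).trans hzx)).trans (hG x hx) f hf
    rw [map_neg] at h1
    exact neg_le.1 h1
  · rintro _ ⟨z, ⟨x, hx, hzx⟩, rfl⟩
    exact (evalBidual_mono ((le_abs_self z).trans hzx)).trans (hG x hx)

end VectorLatticeDual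

/-! ### Norm bounds, disjoint sequences and the equivalence in Banach lattices. -/

section BanachLattice

universe u

variable {X : Type u} [NormedAddCommGroup X] [NormedSpace ℝ X] [Lattice X]
  [IsOrderedAddMonoid X] [IsOrderedModule ℝ X] [HasSolidNorm X]

theorem ContinuousLinearMap.isOrderBoundedFunctional (f : X →L[ℝ] ℝ) :
    IsOrderBoundedFunctional (f : X →ₗ[ℝ] ℝ) := by
  refine fun a b => ⟨‖f‖ * (‖a‖ + ‖b‖), fun x hx => ?_⟩
  have h : |x| ≤ |(|a| + |b|)| := by
    rw [abs_of_nonneg (add_nonneg (abs_nonneg a) (abs_nonneg b))]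
    refine abs_le'.2 ⟨hx.2.trans ((le_abs_self b).trans
      (le_add_of_nonneg_left (abs_nonneg a))), ?_⟩
    exact (neg_le_neg hx.1).trans ((neg_le_abs a).trans (le_add_of_nonneg_right (abs_nonneg b)))
  refine (f.le_opNorm x).trans (mul_le_mul_of_nonneg_left ?_ (norm_nonneg f))
  refine (norm_le_norm_of_abs_le_abs h).trans ((norm_add_le _ _).trans ?_)
  rw [norm_abs_eq_norm, norm_abs_eq_norm]

/-- A norm continuous functional is order bounded, hence a difference of positive ones, and each of
these is bounded on A by the order bounds in the bidual. Banach–Steinhaus on the norm dual then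
applies. -/
theorem IsBOrderBounded.exists_norm_le {A : Set X} (hA : IsBOrderBounded A) :
    ∃ C : ℝ, ∀ x ∈ A, ‖x‖ ≤ C := by
  obtain ⟨C, hC⟩ := banach_steinhaus
    (g := fun x : A => NormedSpace.inclusionInDoubleDual ℝ X x) (by
      intro f
      obtain ⟨p, q, hp, hq, hf⟩ := orderBoundedDual.generatingCone
        rieszDecomposition_of_lattice generatingCone_of_lattice
        (⟨(f : X →ₗ[ℝ] ℝ), f.isOrderBoundedFunctional⟩ : orderBoundedDual X)
      obtain ⟨⟨L, hL⟩, ⟨F, hF⟩⟩ := hA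
      refine ⟨max |L.1 p| |F.1 p| + max |L.1 q| |F.1 q|, fun x => ?_⟩
      have hx1 := hL ⟨x, x.2, rfl⟩
      have hx2 := hF ⟨x, x.2, rfl⟩
      have hfx : f x = p.1 x - q.1 x := by
        have := congrArg (fun g : orderBoundedDual X => g.1 (x : X)) hf
        exact this
      rw [NormedSpace.dual_def, hfx, Real.norm_eq_abs]
      exact (abs_sub _ _).trans (add_le_add
        (abs_le_max_abs_abs (hx1 p hp) (hx2 p hp)) (abs_le_max_abs_abs (hx1 q hq) (hx2 q hq))))
  refine ⟨C, fun x hx => ?_⟩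
  have h := hC ⟨x, hx⟩
  exact ((NormedSpace.inclusionInDoubleDualLi (E := X) ℝ).norm_map x).symm.le.trans h

theorem nonpos_of_forall_nsmul_le {w u : X} (h : ∀ n : ℕ, n • w ≤ u) : w ≤ 0 := by
  have h2 : ∀ n : ℕ, 0 < n → w ≤ (n : ℝ)⁻¹ • u := fun n hn => by
    have hn' : (0 : ℝ) < n := Nat.cast_pos.2 hn
    have := smul_le_smul_of_nonneg_left (h n) (inv_nonneg.2 hn'.le)
    rwa [← Nat.cast_smul_eq_nsmul ℝ, inv_smul_smul₀ hn'.ne'] at this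
  have h3 : Tendsto (fun n : ℕ => (n : ℝ)⁻¹ • u) atTop (𝓝 0) := by
    simpa using (tendsto_inv_atTop_nhds_zero_nat (𝕜 := ℝ)).smul_const u
  exact ge_of_tendsto h3 ((eventually_gt_atTop 0).mono h2)

/-- Disjoint sequences are unbounded order null. -/
theorem uoConverges_of_disjoint {x : ℕ → X} (hd : ∀ m n : ℕ, m ≠ n → |x m| ⊓ |x n| = 0) :
    UOConverges x 0 := by
  intro u hu
  simp only [sub_zero]
  set z : ℕ → X := fun n => |x n| ⊓ u
  have hz : ∀ n, 0 ≤ z n := fun n => le_inf (abs_nonneg _) hu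
  have hdz : ∀ m n, m ≠ n → z m ⊓ z n = 0 := fun m n hmn =>
    le_antisymm ((inf_le_inf inf_le_left inf_le_left).trans (hd m n hmn).le)
      (le_inf (hz m) (hz n))
  refine ⟨{d | ∃ i₀, ∀ i, i₀ ≤ i → z i ≤ d}, ⟨u, 0, fun _ _ => inf_le_right⟩, ?_, ⟨?_, ?_⟩, ?_⟩
  · rintro a ⟨i, hi⟩ b ⟨j, hj⟩
    exact ⟨a ⊓ b, ⟨max i j, fun k hk => le_inf (hi k (le_of_max_le_left hk))
      (hj k (le_of_max_le_right hk))⟩, inf_le_left, inf_le_right⟩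
  · rintro d ⟨i, hi⟩
    exact (hz i).trans (hi i le_rfl)
  · intro w hw
    -- If v dominates every z n, then v minus a partial sum still dominates the tail, so it lies
    -- above the lower bound w. Hence v - w again dominates every z n; iterating from v = u
    -- contradicts the Archimedean property unless w ≤ 0.
    have step : ∀ m : ℕ, ∀ n, z n ≤ u - m • w := by
      intro m
      induction m with
      | zero => intro n; rw [zero_nsmul, sub_zero]; exact inf_le_right
      | succ m ih =>
        intro n
        have h1 : w ≤ (u - m • w) - ∑ i ∈ Finset.range (n + 1), z i :=
          hw ⟨n + 1, fun i hi => sub_sum_ge_of_disjoint hz hdz ih hi⟩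
        have h2 : z n ≤ ∑ i ∈ Finset.range (n + 1), z i :=
          Finset.single_le_sum (fun i _ => hz i) (Finset.self_mem_range_succ n)
        rw [succ_nsmul, ← sub_sub]
        exact h2.trans (le_sub_comm.1 h1)
    exact nonpos_of_forall_nsmul_le fun m => sub_nonneg.1 ((hz 0).trans (step m 0))
  · rintro d ⟨i, hi⟩
    refine ⟨i, fun k hk => ?_⟩
    rw [sub_zero, abs_of_nonneg (hz k)]
    exact hi k hk

/-- The index set `ℕ × [-u, u]` of the net `n⁻¹ z`, directed by the first coordinate. -/
structure ScaledInterval (u : X) where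
  /-- the scaling index -/
  index : ℕ
  /-- the point of the interval -/
  point : X
  abs_point_le : |point| ≤ u

instance (u : X) : Preorder (ScaledInterval u) := Preorder.lift ScaledInterval.index

instance (u : X) : IsDirectedOrder (ScaledInterval u) :=
  ⟨fun i j => ⟨⟨max i.index j.index, i.point, i.abs_point_le⟩,
    Nat.le_max_left i.index j.index, Nat.le_max_right i.index j.index⟩⟩

theorem ScaledInterval.orderConverges {u : X} (hu : 0 ≤ u) :
    OrderConverges (fun i : ScaledInterval u => ((i.index : ℝ) + 1)⁻¹ • i.point) 0 := by
  have hanti : ∀ m n : ℕ, m ≤ n → ((n : ℝ) + 1)⁻¹ • u ≤ ((m : ℝ) + 1)⁻¹ • u := fun m n h =>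
    smul_le_smul_of_nonneg_right (by gcongr) hu
  refine ⟨Set.range fun n : ℕ => ((n : ℝ) + 1)⁻¹ • u, Set.range_nonempty _, ?_, ⟨?_, ?_⟩, ?_⟩
  · rintro _ ⟨m, rfl⟩ _ ⟨n, rfl⟩
    exact ⟨_, ⟨max m n, rfl⟩, hanti _ _ (le_max_left m n), hanti _ _ (le_max_right m n)⟩
  · rintro _ ⟨m, rfl⟩
    exact smul_nonneg (by positivity) hu
  · intro w hw
    have h3 : Tendsto (fun n : ℕ => ((n : ℝ) + 1)⁻¹ • u) atTop (𝓝 0) := by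
      simpa using (tendsto_one_div_add_atTop_nhds_zero_nat (𝕜 := ℝ)).smul_const u
    exact ge_of_tendsto' h3 fun n => hw ⟨n, rfl⟩
  · rintro _ ⟨m, rfl⟩
    refine ⟨⟨m, 0, by simpa using hu⟩, fun i hi => ?_⟩
    have hpos : (0 : ℝ) ≤ ((i.index : ℝ) + 1)⁻¹ := by positivity
    rw [sub_zero]
    refine le_trans ?_ (hanti m i.index hi)
    have h1 := smul_le_smul_of_nonneg_left i.abs_point_le hpos
    refine abs_le'.2 ⟨(smul_le_smul_of_nonneg_left (le_abs_self _) hpos).trans h1, ?_⟩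
    rw [← smul_neg]
    exact (smul_le_smul_of_nonneg_left (neg_le_abs _) hpos).trans h1

/-- Order continuous functionals are order bounded. -/
theorem IsOrderContinuousFunctional.isOrderBoundedFunctional {y : X →ₗ[ℝ] ℝ}
    (hy : IsOrderContinuousFunctional y) : IsOrderBoundedFunctional y := by
  intro a b
  obtain ⟨u, hu, hab⟩ : ∃ u : X, 0 ≤ u ∧ ∀ x ∈ Set.Icc a b, |x| ≤ u :=
    ⟨|a| + |b|, add_nonneg (abs_nonneg a) (abs_nonneg b), fun x hx => abs_le'.2
      ⟨hx.2.trans ((le_abs_self b).trans (le_add_of_nonneg_left (abs_nonneg a))),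
        (neg_le_neg hx.1).trans
          ((neg_le_abs a).trans (le_add_of_nonneg_right (abs_nonneg b)))⟩⟩
  have : Nonempty (ScaledInterval u) := ⟨⟨0, 0, by simpa using hu⟩⟩
  obtain ⟨i₀, hi₀⟩ := eventually_atTop.1 (Metric.tendsto_nhds.1
    (hy (ScaledInterval u) _ (ScaledInterval.orderConverges hu)) 1 one_pos)
  refine ⟨(i₀.index : ℝ) + 1, fun x hx => ?_⟩
  -- The order ignores the point, so one index controls the whole interval at once.
  have h1 := hi₀ ⟨i₀.index, x, hab x hx⟩ (Nat.le_refl i₀.index)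
  have hpos : (0 : ℝ) < (i₀.index : ℝ) + 1 := by positivity
  rw [Real.dist_0_eq_abs, map_smul, smul_eq_mul, abs_mul, abs_of_pos (inv_pos.2 hpos),
    inv_mul_lt_iff₀ hpos, mul_one] at h1
  exact h1.le

/-- With d = a - δ • w, p lies below d⁺ and q below a multiple of d⁻, and these are disjoint.
Scaling by c + 1 rather than c keeps the factor at least 1. -/
theorem inf_eq_zero_of_le_posPart_sub_smul {a w p q : X} {δ c : ℝ} (hc : 0 ≤ c)
    (hp : p ≤ (a - δ • w)⁺) (hq : q ≤ c • (δ • w - a)⁺) (hp0 : 0 ≤ p) (hq0 : 0 ≤ q) :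
    p ⊓ q = 0 := by
  refine le_antisymm ?_ (le_inf hp0 hq0)
  set d := a - δ • w
  have hd : (δ • w - a)⁺ = d⁻ := by rw [← posPart_neg, neg_sub]
  rw [hd] at hq
  have hc1 : (0 : ℝ) < c + 1 := by linarith
  have hpq : 0 ≤ p ⊓ q := le_inf hp0 hq0
  have h1 : (c + 1)⁻¹ • (p ⊓ q) ≤ d⁺ ⊓ d⁻ := by
    refine le_inf ?_ ?_
    · have h : (c + 1)⁻¹ • (p ⊓ q) ≤ (1 : ℝ) • (p ⊓ q) :=
        smul_le_smul_of_nonneg_right (inv_le_one_of_one_le₀ (by linarith)) hpq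
      rw [one_smul] at h
      exact h.trans (inf_le_left.trans hp)
    · have h : q ≤ (c + 1) • d⁻ :=
        hq.trans (smul_le_smul_of_nonneg_right (by linarith) (negPart_nonneg d))
      have h' := smul_le_smul_of_nonneg_left (inf_le_right.trans h : p ⊓ q ≤ _)
        (inv_nonneg.2 hc1.le)
      rwa [inv_smul_smul₀ hc1.ne'] at h'
  rw [posPart_inf_negPart_eq_zero] at h1
  have h2 := smul_le_smul_of_nonneg_left h1 hc1.le
  rwa [smul_inv_smul₀ hc1.ne', smul_zero] at h2

/-- If an order bounded functional tends to zero along disjoint sequences of a norm bounded solid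
set, then that set is almost order bounded with respect to the functional. -/
theorem exists_forall_abs_apply_posPart_sub_le [CompleteSpace X] {y : X →ₗ[ℝ] ℝ}
    (hy : IsOrderBoundedFunctional y) {S : Set X} {C : ℝ} (hC : ∀ x ∈ S, ‖x‖ ≤ C)
    (hS : ∀ x z : X, 0 ≤ z → z ≤ x → x ∈ S → z ∈ S)
    (hdis : ∀ v : ℕ → X, (∀ n, v n ∈ S) → (∀ m n : ℕ, m ≠ n → |v m| ⊓ |v n| = 0) →
      Tendsto (fun n => y (v n)) atTop (𝓝 0)) {ε : ℝ} (hε : 0 < ε) :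
    ∃ u : X, 0 ≤ u ∧ ∀ x ∈ S, 0 ≤ x → |y (x - u)⁺| ≤ ε := by
  by_contra! hcon
  choose! c hcS hc0 hcy using hcon
  -- s n is the sum of the earlier x k, and x n is a counterexample for the candidate u = 4 ^ n • s
  -- n.
  let s : ℕ → X := fun n => Nat.rec 0 (fun n s => s + c ((4 : ℝ) ^ n • s)) n
  let x : ℕ → X := fun n => c ((4 : ℝ) ^ n • s n)
  have hs_succ : ∀ n, s (n + 1) = s n + x n := fun n => rfl
  have hs0 : ∀ n, 0 ≤ s n := by
    intro n
    induction n with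
    | zero => exact le_rfl
    | succ n ih =>
      rw [hs_succ]
      exact add_nonneg ih (hc0 _ (smul_nonneg (by positivity) ih))
  have hsm : ∀ n, 0 ≤ (4 : ℝ) ^ n • s n := fun n => smul_nonneg (by positivity) (hs0 n)
  have hx0 : ∀ n, 0 ≤ x n := fun n => hc0 _ (hsm n)
  have hxS : ∀ n, x n ∈ S := fun n => hcS _ (hsm n)
  have hxy : ∀ n, ε < |y (x n - (4 : ℝ) ^ n • s n)⁺| := fun n => hcy _ (hsm n)
  have hmono : Monotone s := monotone_nat_of_le_succ fun n => by
    rw [hs_succ]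
    exact le_add_of_nonneg_right (hx0 n)
  have hxs : ∀ n m, n < m → x n ≤ s m := fun n m h =>
    (by rw [hs_succ]; exact le_add_of_nonneg_left (hs0 n) : x n ≤ s (n + 1)).trans (hmono h)
  have hsum : Summable fun n => ((1 / 2 : ℝ)) ^ n • x n := by
    refine Summable.of_norm_bounded (g := fun n => (1 / 2 : ℝ) ^ n * C)
      (summable_geometric_two.mul_right C) fun n => ?_
    rw [norm_smul, Real.norm_of_nonneg (by positivity)]
    exact mul_le_mul_of_nonneg_left (hC _ (hxS n)) (by positivity)
  set w := ∑' n, ((1 / 2 : ℝ)) ^ n • x n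
  have hterm : ∀ n, 0 ≤ (1 / 2 : ℝ) ^ n • x n := fun n => smul_nonneg (by positivity) (hx0 n)
  have hw0 : 0 ≤ w := tsum_nonneg hterm
  have hxw : ∀ n, x n ≤ (2 : ℝ) ^ n • w := fun n => by
    have h1 : (1 / 2 : ℝ) ^ n • x n ≤ w := hsum.le_tsum n fun i _ => hterm i
    have h2 := smul_le_smul_of_nonneg_left h1 (by positivity : (0 : ℝ) ≤ 2 ^ n)
    rwa [smul_smul, ← mul_pow, mul_one_div_cancel two_ne_zero, one_pow, one_smul] at h2
  have hδw : ∀ n : ℕ, 0 ≤ (1 / 2 : ℝ) ^ n • w := fun n => smul_nonneg (by positivity) hw0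
  set a : ℕ → X := fun n => x n - (4 : ℝ) ^ n • s n
  -- Subtracting 2⁻ⁿ w makes the humps exactly disjoint, while changing (a n)⁺ by at most 2⁻ⁿ w,
  -- which y sends to 0 by order boundedness.
  set v : ℕ → X := fun n => (a n - (1 / 2 : ℝ) ^ n • w)⁺
  have hv0 : ∀ n, 0 ≤ v n := fun n => posPart_nonneg _
  have hax : ∀ n, a n ≤ x n := fun n => sub_le_self _ (hsm n)
  have hva : ∀ n, v n ≤ (a n)⁺ := fun n => posPart_mono (sub_le_self _ (hδw n))
  have hvS : ∀ n, v n ∈ S := fun n => hS (x n) (v n) (hv0 n)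
    ((hva n).trans (sup_le (hax n) (hx0 n))) (hxS n)
  have hlt : ∀ n m, n < m → v n ⊓ v m = 0 := by
    intro n m hnm
    -- For n < m: a m ≤ 2ᵐ w - 4ᵐ x n ≤ 4ᵐ (2⁻ⁿ w - x n), because x m ≤ 2ᵐ w and x n ≤ s m. This is
    -- where the growth rate 4 is used.
    refine inf_eq_zero_of_le_posPart_sub_smul (a := x n) (w := w) (δ := (1 / 2 : ℝ) ^ n)
      (c := (4 : ℝ) ^ m) (by positivity) (posPart_mono (sub_le_sub_right (hax n) _)) ?_
      (hv0 n) (hv0 m)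
    refine sup_le ?_ (smul_nonneg (by positivity) (posPart_nonneg _))
    have h4 : (0 : ℝ) ≤ 4 ^ m := by positivity
    refine le_trans ?_ (smul_le_smul_of_nonneg_left (le_posPart _) h4)
    refine (sub_le_self _ (hδw m)).trans ?_
    rw [smul_sub, smul_smul]
    refine sub_le_sub ((hxw m).trans (smul_le_smul_of_nonneg_right ?_ hw0))
      (smul_le_smul_of_nonneg_left (hxs n m hnm) h4)
    calc (2 : ℝ) ^ m = 4 ^ m * (1 / 2) ^ m := by rw [← mul_pow]; norm_num
      _ ≤ 4 ^ m * (1 / 2) ^ n := mul_le_mul_of_nonneg_left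
        (pow_le_pow_of_le_one (by norm_num) (by norm_num) hnm.le) h4
  have hyv := hdis v hvS (by
    intro m n hmn
    rw [abs_of_nonneg (hv0 m), abs_of_nonneg (hv0 n)]
    rcases hmn.lt_or_gt with h | h
    · exact hlt m n h
    · rw [inf_comm]
      exact hlt n m h)
  obtain ⟨M, hM⟩ := hy 0 w
  have hdiff : ∀ n, |y ((a n)⁺ - v n)| ≤ (1 / 2 : ℝ) ^ n * M := by
    intro n
    have h2 : (0 : ℝ) ≤ 2 ^ n := by positivity
    have h1 : (a n)⁺ - v n ≤ (1 / 2 : ℝ) ^ n • w := by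
      rw [sub_le_iff_le_add']
      refine sup_le ?_ (add_nonneg (hv0 n) (hδw n))
      exact sub_le_iff_le_add.1 (le_posPart _)
    have h3 := smul_le_smul_of_nonneg_left h1 h2
    rw [smul_smul, ← mul_pow, mul_one_div_cancel two_ne_zero, one_pow, one_smul] at h3
    have h4 := hM _ ⟨smul_nonneg h2 (sub_nonneg.2 (hva n)), h3⟩
    rw [map_smul, smul_eq_mul, abs_mul, abs_of_nonneg h2] at h4
    calc |y ((a n)⁺ - v n)| = (1 / 2 : ℝ) ^ n * (2 ^ n * |y ((a n)⁺ - v n)|) := by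
          rw [← mul_assoc, ← mul_pow]; norm_num
      _ ≤ _ := mul_le_mul_of_nonneg_left h4 (by positivity)
  have hd0 : Tendsto (fun n => y ((a n)⁺ - v n)) atTop (𝓝 0) := by
    refine squeeze_zero_norm hdiff ?_
    simpa using (tendsto_pow_atTop_nhds_zero_of_lt_one (r := (1 / 2 : ℝ)) (by norm_num)
      (by norm_num)).mul_const M
  have hya : Tendsto (fun n => |y (a n)⁺|) atTop (𝓝 0) := by
    have := (hd0.add hyv).abs
    simpa [← map_add] using this
  exact absurd (ge_of_tendsto' hya fun n => (hxy n).le) (not_le.2 hε)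

theorem mem_bbuoDual_of_disjoint [CompleteSpace X] {y : X →ₗ[ℝ] ℝ}
    (hy : IsOrderContinuousFunctional y)
    (hdis : ∀ x : ℕ → X, IsBOrderBounded (Set.range x) →
      (∀ m n : ℕ, m ≠ n → |x m| ⊓ |x n| = 0) → Tendsto (fun n => y (x n)) atTop (𝓝 0)) :
    y ∈ bbuoDual X := by
  have hyb := hy.isOrderBoundedFunctional
  refine ⟨hyb, fun ι _ _ _ x ⟨huo, i₀, hb⟩ => ?_⟩
  set S := solidHull (x '' Set.Ici i₀)
  have hSb : IsBOrderBounded S := hb.solidHull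
  obtain ⟨C, hC⟩ := hSb.exists_norm_le
  have hpS : ∀ i, i₀ ≤ i → (x i)⁺ ∈ S := fun i hi => ⟨x i, ⟨i, hi, rfl⟩, by
    rw [abs_of_nonneg (posPart_nonneg _), ← posPart_add_negPart]
    exact le_add_of_nonneg_right (negPart_nonneg _)⟩
  have hnS : ∀ i, i₀ ≤ i → (x i)⁻ ∈ S := fun i hi => ⟨x i, ⟨i, hi, rfl⟩, by
    rw [abs_of_nonneg (negPart_nonneg _), ← posPart_add_negPart]
    exact le_add_of_nonneg_left (posPart_nonneg _)⟩
  rw [Metric.tendsto_nhds]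
  intro ε hε
  obtain ⟨u, hu, hyu⟩ := exists_forall_abs_apply_posPart_sub_le hyb hC
    (by
      rintro a z hz hza ⟨b, hb, hab⟩
      exact ⟨b, hb, (abs_le_abs_of_nonneg hz hza).trans hab⟩)
    (fun v hv hvd => hdis v (hSb.mono (Set.range_subset_iff.2 hv)) hvd)
    (show 0 < ε / 4 by linarith)
  -- This is z + u = z ⊔ u + z ⊓ u, with (z - u)⁺ = z ⊔ u - u.
  have hsplit : ∀ z : X, z = (z - u)⁺ + z ⊓ u := fun z => by
    rw [posPart_def, ← sub_self u, ← sup_sub, inf_comm, eq_comm, sub_add_eq_add_sub,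
      sub_eq_iff_eq_add, add_comm, inf_comm, inf_add_sup, add_comm]
  have huo' := huo u hu
  simp only [sub_zero] at huo'
  have hle : ∀ z t : X, 0 ≤ z → z ≤ t → |z ⊓ u| ≤ |t ⊓ u| := fun z t hz hzt =>
    abs_le_abs_of_nonneg (le_inf hz hu) (inf_le_inf_right u hzt)
  have hp := hy ι (fun i => (x i)⁺ ⊓ u) (huo'.of_abs_le fun i =>
    hle _ _ (posPart_nonneg _) (by
      rw [← posPart_add_negPart]; exact le_add_of_nonneg_right (negPart_nonneg _)))
  have hn := hy ι (fun i => (x i)⁻ ⊓ u) (huo'.of_abs_le fun i =>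
    hle _ _ (negPart_nonneg _) (by
      rw [← posPart_add_negPart]; exact le_add_of_nonneg_left (posPart_nonneg _)))
  rw [Metric.tendsto_nhds] at hp hn
  filter_upwards [hp (ε / 4) (by linarith), hn (ε / 4) (by linarith), eventually_ge_atTop i₀]
    with i h1 h2 hi
  have h3 := hyu _ (hpS i hi) (posPart_nonneg _)
  have h4 := hyu _ (hnS i hi) (negPart_nonneg _)
  have h5 : y (x i) = (y ((x i)⁺ - u)⁺ + y ((x i)⁺ ⊓ u)) - (y ((x i)⁻ - u)⁺ + y ((x i)⁻ ⊓ u)) := by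
    rw [← map_add, ← map_add, ← hsplit, ← hsplit, ← map_sub, posPart_sub_negPart]
  rw [Real.dist_0_eq_abs] at h1 h2 ⊢
  rw [h5]
  rw [abs_lt] at h1 h2 ⊢
  rw [abs_le] at h3 h4
  constructor <;> linarith

theorem tendsto_of_mem_bbuoDual {y : X →ₗ[ℝ] ℝ} (hy : y ∈ bbuoDual X) {x : ℕ → X}
    (hb : IsBOrderBounded (Set.range x)) (hx : UOConverges x 0) :
    Tendsto (fun n => y (x n)) atTop (𝓝 0) := by
  have : IsDirectedOrder (ULift.{u} ℕ) := ⟨fun i j => ⟨⟨max i.down j.down⟩,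
    (le_max_left i.down j.down : _), (le_max_right i.down j.down : _)⟩⟩
  have h := hy.2 (ULift.{u} ℕ) (fun i => x i.down)
    ⟨fun v hv => (hx v hv).comp_uliftDown, ⟨0⟩, hb.mono (by
      rintro _ ⟨i, -, rfl⟩
      exact ⟨i.down, rfl⟩)⟩
  rw [Metric.tendsto_atTop] at h ⊢
  intro ε hε
  obtain ⟨N, hN⟩ := h ε hε
  exact ⟨N.down, fun n hn => hN ⟨n⟩ hn⟩

end BanachLattice

theorem theorem3p3 {X : Type*} [NormedAddCommGroup X] [NormedSpace ℝ X] [CompleteSpace X]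
    [Lattice X] [IsOrderedAddMonoid X] [IsOrderedModule ℝ X] [HasSolidNorm X]
    (y : X →ₗ[ℝ] ℝ) (hy : IsOrderContinuousFunctional y) :
    List.TFAE
      [y ∈ bbuoDual X,
       ∀ x : ℕ → X, IsBOrderBounded (Set.range x) → UOConverges x 0 →
         Tendsto (fun n => y (x n)) atTop (𝓝 0),
       ∀ x : ℕ → X, IsBOrderBounded (Set.range x) →
         (∀ m n : ℕ, m ≠ n → |x m| ⊓ |x n| = 0) →
         Tendsto (fun n => y (x n)) atTop (𝓝 0)] := by
  tfae_have 1 → 2 := fun h _ hb hx => tendsto_of_mem_bbuoDual h hb hx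
  tfae_have 2 → 3 := fun h x hb hd => h x hb (uoConverges_of_disjoint hd)
  tfae_have 3 → 1 := mem_bbuoDual_of_disjoint hy
  tfae_finish
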